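/- For $n\ge 0$ let $\Lambda(n)$ be the set of untyped $\lambda$-terms with free variables among $x_1,\dots,x_n$, modulo $\beta$-equality; with the variables as projections and substitution as composition these sets form an algebraic theory $\Lambda$. A $\Lambda$-algebra is a set $A$ with maps $\Lambda(m)\times A^m\to A$, $(t,\mathbf a)\mapsto t(\mathbf a)$ ($m\ge 0$), for which variables act as projections and substitution of terms acts as composition; a homomorphism is a map that commutes with these actions. In a $\Lambda$-algebra $A$, terms with parameters from $A$ denote elements of $A$; in particular there is a binary application $(a,b)\mapsto ab$ and each closed term denotes an element of $A$. Let $\mathrm{app}_n=\lambda x z_1\cdots z_n.\,x z_1\cdots z_n$. Let $A$ be a $\Lambda$-algebra and $n\ge 0$. Then the retract $A(n)=\{a\in A : \mathrm{app}_n\,a=a\}$ carries a canonical $\Lambda$-algebra structure, given for $t\in\Lambda(m)$ and $a_1,\dots,a_m\in A(n)$ by $$t(a_1,\dots,a_m)=\lambda z_1\cdots z_n.\;t(a_1z_1\cdots z_n,\dots,a_mz_1\cdots z_n),$$ and with this structure $A(n)$ is the free $\Lambda$-algebra extending $A$ by $n$ indeterminates. That is, the map $\iota:A\to A(n)$, $\iota(a)=\lambda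 z_1\cdots z_n.\,a$, is a homomorphism, the elements $\xi_i=\lambda z_1\cdots z_n.\,z_i$ ($1\le i\le n$) lie in $A(n)$, and for every $\Lambda$-algebra $B$, every homomorphism $f:A\to B$ and all $b_1,\dots,b_n\in B$ there is exactly one homomorphism $g:A(n)\to B$ with $g\circ\iota=f$ and $g(\xi_i)=b_i$ for $1\le i\le n$. -/

import Mathlib

universe u v w

/-- An algebraic theory (cartesian operad, abstract clone): sets of `n`-ary operations with
projections and an associative, unital composition. The action of a map `f : Fin n → Fin m` of
finite sets is `t ↦ comp t (fun i => pr (f i))`; functoriality of it and naturality of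
composition are consequences of the three laws. -/
structure AlgTheory where
  Op : ℕ → Type u
  pr : {n : ℕ} → Fin n → Op n
  comp : {n m : ℕ} → Op n → (Fin n → Op m) → Op m
  pr_comp : ∀ {n m : ℕ} (i : Fin n) (s : Fin n → Op m), comp (pr i) s = s i
  comp_pr : ∀ {n : ℕ} (t : Op n), comp t pr = t
  comp_assoc : ∀ {n m k : ℕ} (t : Op n) (s : Fin n → Op m) (r : Fin m → Op k),
    comp (comp t s) r = comp t (fun i => comp (s i) r)

namespace AlgTheory

/-- The structure of a `T`-algebra on a set `A`: a unital associative action of `T`. -/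
@[ext]
structure Alg (T : AlgTheory.{u}) (A : Type v) where
  act : {n : ℕ} → T.Op n → (Fin n → A) → A
  act_pr : ∀ {n : ℕ} (i : Fin n) (a : Fin n → A), act (T.pr i) a = a i
  act_comp : ∀ {n m : ℕ} (t : T.Op n) (s : Fin n → T.Op m) (a : Fin m → A),
    act (T.comp t s) a = act t (fun i => act (s i) a)

/-- Homomorphisms of `T`-algebras. -/
@[ext]
structure Hom {T : AlgTheory.{u}} {A : Type v} {B : Type w} (SA : Alg T A) (SB : Alg T B) where
  toFun : A → B
  map_act : ∀ {n : ℕ} (t : T.Op n) (a : Fin n → A),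
    toFun (SA.act t a) = SB.act t (fun i => toFun (a i))

/-- The homomorphism `ι : A → C` and the elements `x₁, …, xₙ` exhibit `C` as the free extension
of the `T`-algebra `A` by `n` indeterminates; the test algebras `B` live in `Type w`. -/
def IsFreeExtension {T : AlgTheory.{u}} {A C : Type v} {SA : Alg T A} {SC : Alg T C}
    {n : ℕ} (ι : Hom SA SC) (x : Fin n → C) : Prop :=
  ∀ (B : Type w) (SB : Alg T B) (f : Hom SA SB) (b : Fin n → B),
    ∃! g : Hom SC SB, (∀ a, g.toFun (ι.toFun a) = f.toFun a) ∧ ∀ i, g.toFun (x i) = b i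

end AlgTheory

/-- Untyped lambda terms in a context of `n` variables (well-scoped, nameless). The variable
bound by `lam` is the last one of the extended context. -/
inductive LTerm : ℕ → Type
  | var {n : ℕ} : Fin n → LTerm n
  | app {n : ℕ} : LTerm n → LTerm n → LTerm n
  | lam {n : ℕ} : LTerm (n + 1) → LTerm n

namespace LTerm

/-- Extension of a renaming by the new last variable. -/
def liftRen {n m : ℕ} (f : Fin n → Fin m) : Fin (n + 1) → Fin (m + 1) :=
  Fin.lastCases (motive := fun _ => Fin (m + 1)) (Fin.last m) (fun i => (f i).castSucc)

/-- Renaming of variables. -/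
def rename : {n m : ℕ} → (Fin n → Fin m) → LTerm n → LTerm m
  | _, _, f, var i => var (f i)
  | _, _, f, app s t => app (rename f s) (rename f t)
  | _, _, f, lam s => lam (rename (liftRen f) s)

/-- Extension of a substitution by the new last variable. -/
def liftSub {n m : ℕ} (σ : Fin n → LTerm m) : Fin (n + 1) → LTerm (m + 1) :=
  Fin.lastCases (motive := fun _ => LTerm (m + 1)) (var (Fin.last m))
    (fun i => rename Fin.castSucc (σ i))

/-- Simultaneous capture-avoiding substitution. -/
def subst : {n m : ℕ} → (Fin n → LTerm m) → LTerm n → LTerm m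
  | _, _, σ, var i => σ i
  | _, _, σ, app s t => app (subst σ s) (subst σ t)
  | _, _, σ, lam s => lam (subst (liftSub σ) s)

/-- The substitution of `u` for the last variable, all others being fixed. -/
def single {n : ℕ} (u : LTerm n) : Fin (n + 1) → LTerm n :=
  Fin.lastCases (motive := fun _ => LTerm n) u var

/-- Beta-equality: the congruence generated by `(λ z. s) u = s[u / z]`. -/
inductive BetaEq : {n : ℕ} → LTerm n → LTerm n → Prop
  | beta {n : ℕ} (s : LTerm (n + 1)) (u : LTerm n) : BetaEq (app (lam s) u) (subst (single u) s)
  | refl {n : ℕ} (s : LTerm n) : BetaEq s s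
  | symm {n : ℕ} {s t : LTerm n} : BetaEq s t → BetaEq t s
  | trans {n : ℕ} {s t r : LTerm n} : BetaEq s t → BetaEq t r → BetaEq s r
  | app {n : ℕ} {s s' t t' : LTerm n} : BetaEq s s' → BetaEq t t' → BetaEq (app s t) (app s' t')
  | lam {n : ℕ} {s s' : LTerm (n + 1)} : BetaEq s s' → BetaEq (lam s) (lam s')

@[simp] theorem liftRen_last {n m : ℕ} (f : Fin n → Fin m) :
    liftRen f (Fin.last n) = Fin.last m := by simp [liftRen]

@[simp] theorem liftRen_castSucc {n m : ℕ} (f : Fin n → Fin m) (i : Fin n) :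
    liftRen f i.castSucc = (f i).castSucc := by simp [liftRen]

@[simp] theorem liftSub_last {n m : ℕ} (σ : Fin n → LTerm m) :
    liftSub σ (Fin.last n) = var (Fin.last m) := by simp [liftSub]

@[simp] theorem liftSub_castSucc {n m : ℕ} (σ : Fin n → LTerm m) (i : Fin n) :
    liftSub σ i.castSucc = rename Fin.castSucc (σ i) := by simp [liftSub]

@[simp] theorem single_last {n : ℕ} (u : LTerm n) : single u (Fin.last n) = u := by
  simp [single]

@[simp] theorem single_castSucc {n : ℕ} (u : LTerm n) (i : Fin n) :
    single u i.castSucc = var i := by simp [single]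

theorem subst_rename {n m k : ℕ} (f : Fin n → Fin m) (σ : Fin m → LTerm k) (t : LTerm n) :
    subst σ (rename f t) = subst (fun i => σ (f i)) t := by
  induction t generalizing m k with
  | var i => rfl
  | app s t hs ht => simp [rename, subst, hs, ht]
  | lam s hs =>
    simp only [rename, subst, hs]
    congr 2
    funext i
    refine Fin.lastCases ?_ (fun i => ?_) i <;> simp

theorem rename_eq_subst {n m : ℕ} (f : Fin n → Fin m) (t : LTerm n) :
    rename f t = subst (fun i => var (f i)) t := by
  induction t generalizing m with
  | var i => rfl
  | app s t hs ht => simp [rename, subst, hs, ht]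
  | lam s hs =>
    simp only [rename, subst, hs]
    congr 2
    funext i
    refine Fin.lastCases ?_ (fun i => ?_) i <;> simp [rename]

theorem rename_rename {n m k : ℕ} (f : Fin n → Fin m) (g : Fin m → Fin k) (t : LTerm n) :
    rename g (rename f t) = rename (fun i => g (f i)) t := by
  rw [rename_eq_subst g, subst_rename, rename_eq_subst]

theorem rename_subst {n m k : ℕ} (σ : Fin n → LTerm m) (g : Fin m → Fin k) (t : LTerm n) :
    rename g (subst σ t) = subst (fun i => rename g (σ i)) t := by
  induction t generalizing m k with
  | var i => rfl
  | app s t hs ht => simp [rename, subst, hs, ht]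
  | lam s hs =>
    simp only [rename, subst, hs]
    congr 2
    funext i
    refine Fin.lastCases ?_ (fun i => ?_) i <;> simp [rename, rename_rename]

theorem subst_subst {n m k : ℕ} (σ : Fin n → LTerm m) (τ : Fin m → LTerm k) (t : LTerm n) :
    subst τ (subst σ t) = subst (fun i => subst τ (σ i)) t := by
  induction t generalizing m k with
  | var i => rfl
  | app s t hs ht => simp [subst, hs, ht]
  | lam s hs =>
    simp only [subst, hs]
    congr 2
    funext i
    refine Fin.lastCases ?_ (fun i => ?_) i <;> simp [subst, subst_rename, rename_subst]

theorem subst_var {n : ℕ} (t : LTerm n) : subst var t = t := by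
  induction t with
  | var i => rfl
  | app s t hs ht => simp [subst, hs, ht]
  | lam s hs =>
    have h : ∀ k : ℕ, liftSub (var (n := k)) = var := by
      intro k
      funext i
      refine Fin.lastCases ?_ (fun i => ?_) i <;> simp [rename]
    simp only [subst, h, hs]

theorem BetaEq.subst {n m : ℕ} {s t : LTerm n} (h : BetaEq s t) (σ : Fin n → LTerm m) :
    BetaEq (subst σ s) (subst σ t) := by
  induction h generalizing m with
  | beta s u =>
    have e : LTerm.subst σ (LTerm.subst (single u) s)
        = LTerm.subst (single (LTerm.subst σ u)) (LTerm.subst (liftSub σ) s) := by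
      rw [subst_subst, subst_subst]
      congr 1
      funext i
      refine Fin.lastCases ?_ (fun i => ?_) i
      · simp [LTerm.subst]
      · simp [LTerm.subst, subst_rename, subst_var]
    rw [e]
    exact BetaEq.beta _ _
  | refl s => exact BetaEq.refl _
  | symm _ ih => exact (ih σ).symm
  | trans _ _ ih₁ ih₂ => exact (ih₁ σ).trans (ih₂ σ)
  | app _ _ ih₁ ih₂ => exact BetaEq.app (ih₁ σ) (ih₂ σ)
  | lam _ ih => exact BetaEq.lam (ih _)

theorem BetaEq.subst_congr {n m : ℕ} (t : LTerm n) {σ τ : Fin n → LTerm m}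
    (h : ∀ i, BetaEq (σ i) (τ i)) : BetaEq (LTerm.subst σ t) (LTerm.subst τ t) := by
  induction t generalizing m with
  | var i => exact h i
  | app s t hs ht => exact BetaEq.app (hs h) (ht h)
  | lam s hs =>
    refine BetaEq.lam (hs fun i => ?_)
    refine Fin.lastCases ?_ (fun i => ?_) i
    · simpa using BetaEq.refl _
    · simpa [rename_eq_subst] using (h i).subst _

instance betaSetoid (n : ℕ) : Setoid (LTerm n) where
  r := BetaEq
  iseqv := ⟨BetaEq.refl, BetaEq.symm, BetaEq.trans⟩

end LTerm

/-- `Λ(n)`: lambda terms in `n` variables modulo beta-equality. -/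
def LamOp (n : ℕ) : Type := Quotient (LTerm.betaSetoid n)

namespace LamOp

def mk {n : ℕ} (t : LTerm n) : LamOp n := Quotient.mk _ t

def pr {n : ℕ} (i : Fin n) : LamOp n := mk (LTerm.var i)

/-- Application of terms, on classes. -/
def app {n : ℕ} : LamOp n → LamOp n → LamOp n :=
  Quotient.map₂ LTerm.app fun _ _ h _ _ h' => LTerm.BetaEq.app h h'

/-- Abstraction of the last variable, on classes; the section `λ : Λ(n+1) → Λ(n)`. -/
def lam {n : ℕ} : LamOp (n + 1) → LamOp n :=
  Quotient.map LTerm.lam fun _ _ h => LTerm.BetaEq.lam h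

/-- Substitution, on classes. -/
noncomputable def comp {n m : ℕ} (t : LamOp n) (s : Fin n → LamOp m) : LamOp m :=
  Quotient.map (LTerm.subst fun i => (s i).out) (fun _ _ h => LTerm.BetaEq.subst h _) t

theorem comp_mk {n m : ℕ} (t : LTerm n) (s : Fin n → LTerm m) :
    comp (mk t) (fun i => mk (s i)) = mk (t.subst s) :=
  Quotient.sound (LTerm.BetaEq.subst_congr t fun i => Quotient.mk_out (s i))

theorem exists_mk {n m : ℕ} (s : Fin n → LamOp m) : ∃ s' : Fin n → LTerm m,
    s = fun i => mk (s' i) :=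
  ⟨fun i => (s i).out, funext fun i => (Quotient.out_eq (s i)).symm⟩

end LamOp

/-- The algebraic theory `Λ` of the pure lambda calculus with beta-equality. -/
noncomputable def Lam : AlgTheory.{0} where
  Op := LamOp
  pr := LamOp.pr
  comp := LamOp.comp
  pr_comp i s := by
    obtain ⟨s, rfl⟩ := LamOp.exists_mk s
    exact LamOp.comp_mk _ _
  comp_pr t := by
    obtain ⟨t, rfl⟩ := Quotient.exists_rep t
    exact (LamOp.comp_mk t LTerm.var).trans (congrArg LamOp.mk (LTerm.subst_var t))
  comp_assoc t s r := by
    obtain ⟨t, rfl⟩ := Quotient.exists_rep t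
    obtain ⟨s, rfl⟩ := LamOp.exists_mk s
    obtain ⟨r, rfl⟩ := LamOp.exists_mk r
    change LamOp.comp (LamOp.comp (LamOp.mk t) _) _ = LamOp.comp (LamOp.mk t) _
    simp only [LamOp.comp_mk, LTerm.subst_subst]

namespace Lam

/-- The retraction `ρ : Λ(n) → Λ(n+1)`, `t ↦ t z` with `z` the new last variable. -/
noncomputable def rho {n : ℕ} (t : Lam.Op n) : Lam.Op (n + 1) :=
  LamOp.app (Lam.comp t fun i => Lam.pr i.castSucc) (Lam.pr (Fin.last n))

/-- `t ↦ t z₁ ⋯ zₖ`, from `Λ(n)` to `Λ(n+k)`. -/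
noncomputable def rhoIter {n : ℕ} : (k : ℕ) → Lam.Op n → Lam.Op (n + k)
  | 0, t => t
  | k + 1, t => rho (rhoIter k t)

/-- `t ↦ λ z₁ ⋯ zₖ. t`, from `Λ(n+k)` to `Λ(n)`, where `z₁, …, zₖ` are the last `k` variables. -/
noncomputable def lamIter {n : ℕ} : (k : ℕ) → Lam.Op (n + k) → Lam.Op n
  | 0, t => t
  | k + 1, t => lamIter k (LamOp.lam t)

/-- The binary operation of application, `x y` in `Λ(2)`. -/
noncomputable def appOp : Lam.Op 2 := rho (Lam.pr (0 : Fin 1))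

/-- The constant `app_k = λ x z₁ ⋯ zₖ. x z₁ ⋯ zₖ` in `Λ(0)`. -/
noncomputable def appConst (k : ℕ) : Lam.Op 0 :=
  LamOp.lam (lamIter k (rhoIter k (Lam.pr (0 : Fin 1))))

end Lam

namespace AlgTheory.Alg

variable {A : Type v}

/-- Application `a b` in a `Λ`-algebra. -/
noncomputable def app (S : Alg Lam A) (a b : A) : A := S.act Lam.appOp ![a, b]

/-- Interpretation of a constant (closed term) in a `Λ`-algebra. -/
noncomputable def const (S : Alg Lam A) (c : Lam.Op 0) : A := S.act c Fin.elim0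

/-- The retract `A(n) = {a ∈ A | app_n a = a}`. -/
def retract (S : Alg Lam A) (n : ℕ) : Set A := {a | S.app (S.const (Lam.appConst n)) a = a}

end AlgTheory.Alg

/-! Let ρ append an application to a fresh variable. By β, `rho_lam`, ρ undoes abstraction, and both
commute with substitution (`rho_comp`, `comp_lam`). Iterated n times, ρⁿλⁿ = id, so λⁿρⁿ is
idempotent and A(n) is its image in A. Each algebra law, and the homomorphism law of ι, becomes an
identity in Λ where an inner ρⁿλⁿ cancels; only the projection law needs a = λz₁⋯zₙ. a z₁⋯zₙ. For
the universal property, `evalAt_retractVar` gives a = ι(a) ξ₁⋯ξₙ, computed in A(n), for every a in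
A(n). A homomorphism g extending f with g(ξᵢ) = bᵢ must therefore send a to f(a) b₁⋯bₙ. Conversely,
this formula is a homomorphism and has the required values, because β removes the outer abstractions
(`evalAt_act_lamIter`). -/

namespace Lam

/-! ### Abstraction, application and substitution in Λ -/

/-- Extension of a tuple of operations by the new last variable. -/
noncomputable def lift {n m : ℕ} (s : Fin n → Lam.Op m) : Fin (n + 1) → Lam.Op (m + 1) :=
  Fin.lastCases (motive := fun _ => Lam.Op (m + 1)) (Lam.pr (Fin.last m))
    (fun i => Lam.comp (s i) fun j => Lam.pr j.castSucc)

@[simp] theorem lift_last {n m : ℕ} (s : Fin n → Lam.Op m) :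
    lift s (Fin.last n) = Lam.pr (Fin.last m) := by simp [lift]

@[simp] theorem lift_castSucc {n m : ℕ} (s : Fin n → Lam.Op m) (i : Fin n) :
    lift s i.castSucc = Lam.comp (s i) fun j => Lam.pr j.castSucc := by simp [lift]

/-- Extension of a tuple of operations by `k` new last variables. -/
noncomputable def liftIter {n m : ℕ} (s : Fin n → Lam.Op m) :
    (k : ℕ) → Fin (n + k) → Lam.Op (m + k)
  | 0 => s
  | k + 1 => lift (liftIter s k)

theorem liftIter_castAdd {n m : ℕ} (s : Fin n → Lam.Op m) (k : ℕ) (i : Fin n) :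
    liftIter s k (Fin.castAdd k i) = Lam.comp (s i) fun j => Lam.pr (Fin.castAdd k j) := by
  induction k with
  | zero => exact (Lam.comp_pr (s i)).symm
  | succ k ih =>
    refine (lift_castSucc (liftIter s k) (Fin.castAdd k i)).trans ?_
    rw [ih, Lam.comp_assoc]
    simp only [Lam.pr_comp]
    rfl

theorem liftIter_natAdd {n m : ℕ} (s : Fin n → Lam.Op m) (k : ℕ) (i : Fin k) :
    liftIter s k (Fin.natAdd n i) = Lam.pr (Fin.natAdd m i) := by
  induction k with
  | zero => exact i.elim0
  | succ k ih =>
    refine Fin.lastCases ?_ (fun i => ?_) i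
    · exact lift_last (liftIter s k)
    · refine (lift_castSucc (liftIter s k) (Fin.natAdd n i)).trans ?_
      rw [ih, Lam.pr_comp]
      rfl

theorem comp_app {n m : ℕ} (t u : Lam.Op n) (s : Fin n → Lam.Op m) :
    Lam.comp (LamOp.app t u) s = LamOp.app (Lam.comp t s) (Lam.comp u s) := by
  obtain ⟨t, rfl⟩ := Quotient.exists_rep t
  obtain ⟨u, rfl⟩ := Quotient.exists_rep u
  rfl

theorem lift_mk {n m : ℕ} (s : Fin n → LTerm m) :
    lift (fun i => LamOp.mk (s i)) = fun i => LamOp.mk (LTerm.liftSub s i) := by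
  funext i
  refine Fin.lastCases ?_ (fun i => ?_) i
  · exact (lift_last _).trans (congrArg LamOp.mk (LTerm.liftSub_last s).symm)
  · refine (lift_castSucc _ i).trans ((LamOp.comp_mk (s i) _).trans (congrArg LamOp.mk ?_))
    rw [LTerm.liftSub_castSucc, LTerm.rename_eq_subst]

theorem comp_lam {n m : ℕ} (t : Lam.Op (n + 1)) (s : Fin n → Lam.Op m) :
    Lam.comp (LamOp.lam t) s = LamOp.lam (Lam.comp t (lift s)) := by
  obtain ⟨t, rfl⟩ := Quotient.exists_rep t
  obtain ⟨s, rfl⟩ := LamOp.exists_mk s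
  rw [lift_mk]
  exact (LamOp.comp_mk t.lam s).trans (congrArg LamOp.lam (LamOp.comp_mk t _).symm)

/-- This is β with a variable as argument: weakening under the binder followed by substitution of
the new variable is the identity. -/
theorem rho_lam {n : ℕ} (t : Lam.Op (n + 1)) : rho (LamOp.lam t) = t := by
  obtain ⟨t, rfl⟩ := Quotient.exists_rep t
  have e : Lam.comp (LamOp.lam (LamOp.mk t)) (fun i => Lam.pr i.castSucc)
      = LamOp.mk (t.lam.subst fun i : Fin n => LTerm.var i.castSucc) := LamOp.comp_mk t.lam _
  have e' : (t.subst (LTerm.liftSub fun i : Fin n => LTerm.var i.castSucc)).subst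
      (LTerm.single (LTerm.var (Fin.last n))) = t := by
    rw [LTerm.subst_subst]
    refine Eq.trans (congrArg (fun σ => LTerm.subst σ t) ?_) (LTerm.subst_var t)
    funext i
    refine Fin.lastCases ?_ (fun i => ?_) i <;> simp [LTerm.subst, LTerm.rename]
  change LamOp.app (Lam.comp (LamOp.lam (LamOp.mk t)) _) _ = LamOp.mk t
  rw [e]
  refine Eq.trans (Quotient.sound (LTerm.BetaEq.beta _ _)) (congrArg LamOp.mk e')

theorem rho_comp {n m : ℕ} (t : Lam.Op n) (s : Fin n → Lam.Op m) :
    rho (Lam.comp t s) = Lam.comp (rho t) (lift s) := by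
  simp only [rho, comp_app, Lam.comp_assoc, Lam.pr_comp, lift_castSucc, lift_last]
  rfl

theorem rhoIter_lamIter {n : ℕ} (k : ℕ) (t : Lam.Op (n + k)) :
    rhoIter k (lamIter k t) = t := by
  induction k with
  | zero => rfl
  | succ k ih => exact (congrArg rho (ih (LamOp.lam t))).trans (rho_lam t)

theorem rhoIter_comp {n m : ℕ} (k : ℕ) (t : Lam.Op n) (s : Fin n → Lam.Op m) :
    rhoIter k (Lam.comp t s) = Lam.comp (rhoIter k t) (liftIter s k) := by
  induction k with
  | zero => rfl
  | succ k ih =>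
    change rho (rhoIter k (Lam.comp t s)) = _
    rw [ih, rho_comp]
    rfl

theorem comp_lamIter {n m : ℕ} (k : ℕ) (t : Lam.Op (n + k)) (s : Fin n → Lam.Op m) :
    Lam.comp (lamIter k t) s = lamIter k (Lam.comp t (liftIter s k)) := by
  induction k with
  | zero => rfl
  | succ k ih => exact (ih (LamOp.lam t)).trans (congrArg (lamIter k) (comp_lam t _))

/-- Substitution of `s` in `xᵢ z₁ ⋯ zₖ` gives `sᵢ z₁ ⋯ zₖ`. -/
theorem comp_rhoIter_pr {n m : ℕ} (k : ℕ) (i : Fin n) (s : Fin n → Lam.Op m) :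
    Lam.comp (rhoIter k (Lam.pr i)) (liftIter s k) = rhoIter k (s i) := by
  rw [← rhoIter_comp, Lam.pr_comp]

theorem comp_appOp {n : ℕ} (s : Fin 2 → Lam.Op n) :
    Lam.comp appOp s = LamOp.app (s 0) (s 1) := by
  simp only [appOp, rho, comp_app, Lam.pr_comp]
  rfl

end Lam

/-! ### Transport to an arbitrary Λ-algebra -/

namespace AlgTheory.Alg

variable {A : Type v} (S : Alg Lam A)

theorem app_const_lam (u : Lam.Op 1) (a : A) :
    S.app (S.const (LamOp.lam u)) a = S.act u ![a] := by
  -- β in Λ(1): the closed abstraction is weakened so that it can be applied to the one variable.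
  have e : Lam.comp Lam.appOp
      ![Lam.comp (LamOp.lam u) (fun i => Lam.pr i.castSucc), Lam.pr (0 : Fin 1)] = u := by
    rw [Lam.comp_appOp]
    exact Lam.rho_lam u
  conv_rhs => rw [← e, S.act_comp]
  unfold app
  congr 1
  funext i
  fin_cases i
  · refine Eq.trans ?_ (S.act_comp (LamOp.lam u) (fun i => Lam.pr i.castSucc) ![a]).symm
    exact congrArg (S.act (LamOp.lam u)) (funext fun i => i.elim0)
  · exact (S.act_pr (0 : Fin 1) ![a]).symm

theorem mem_retract {n : ℕ} {a : A} :
    a ∈ S.retract n ↔ S.act (Lam.lamIter n (Lam.rhoIter n (Lam.pr (0 : Fin 1)))) ![a] = a := by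
  change S.app (S.const (LamOp.lam _)) a = a ↔ _
  rw [app_const_lam]

/-- Idempotence of λⁿρⁿ: substituting λⁿu for x in λⁿρⁿx gives λⁿρⁿλⁿu = λⁿu. -/
theorem act_lamIter_mem_retract {n m : ℕ} (u : Lam.Op (m + n)) (a : Fin m → A) :
    S.act (Lam.lamIter n u) a ∈ S.retract n := by
  have e : Lam.comp (Lam.lamIter n (Lam.rhoIter n (Lam.pr (0 : Fin 1))))
      (fun _ => Lam.lamIter n u) = Lam.lamIter n u := by
    rw [Lam.comp_lamIter, Lam.comp_rhoIter_pr, Lam.rhoIter_lamIter]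
  rw [mem_retract]
  conv_rhs => rw [← e, S.act_comp]
  congr 1
  funext i
  fin_cases i
  rfl

theorem act_lamIter_rhoIter_pr {n m : ℕ} (i : Fin m) (a : Fin m → A)
    (h : a i ∈ S.retract n) :
    S.act (Lam.lamIter n (Lam.rhoIter n (Lam.pr i))) a = a i := by
  have e : Lam.comp (Lam.lamIter n (Lam.rhoIter n (Lam.pr (0 : Fin 1)))) (fun _ => Lam.pr i)
      = Lam.lamIter n (Lam.rhoIter n (Lam.pr i)) := by
    rw [Lam.comp_lamIter, Lam.comp_rhoIter_pr]
  rw [← e, S.act_comp]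
  conv_rhs => rw [← S.mem_retract.1 h]
  congr 1
  funext j
  fin_cases j
  exact S.act_pr _ _

/-- `act_comp` for an abstraction whose arguments are abstractions. -/
theorem act_lamIter_act {n m k : ℕ} (u : Lam.Op (m + n)) (s : Fin m → Lam.Op k)
    (a : Fin k → A) :
    S.act (Lam.lamIter n u) (fun i => S.act (s i) a)
      = S.act (Lam.lamIter n (Lam.comp u (Lam.liftIter s n))) a := by
  rw [← S.act_comp, Lam.comp_lamIter]

/-- The lifted substitution fixes the n new variables, so `b` passes through unchanged. -/
theorem act_rhoIter_comp {n m k : ℕ} (t : Lam.Op m) (s : Fin m → Lam.Op k)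
    (a : Fin k → A) (b : Fin n → A) :
    S.act (Lam.rhoIter n (Lam.comp t s)) (Fin.append a b)
      = S.act (Lam.rhoIter n t) (Fin.append (fun i => S.act (s i) a) b) := by
  rw [Lam.rhoIter_comp, S.act_comp]
  congr 1
  funext i
  refine Fin.addCases (fun i => ?_) (fun i => ?_) i
  · simp only [Lam.liftIter_castAdd, S.act_comp, S.act_pr, Fin.append_left]
  · simp only [Lam.liftIter_natAdd, S.act_pr, Fin.append_right]

/-- The value `c b₁ ⋯ bₙ` of an element `c` at `b₁, …, bₙ`. -/
noncomputable def evalAt {n : ℕ} (b : Fin n → A) (c : A) : A :=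
  S.act (Lam.rhoIter n (Lam.pr (0 : Fin 1))) (Fin.append ![c] b)

theorem evalAt_act {n m : ℕ} (b : Fin n → A) (t : Lam.Op m) (c : Fin m → A) :
    S.evalAt b (S.act t c) = S.act (Lam.rhoIter n t) (Fin.append c b) := by
  have e := S.act_rhoIter_comp (Lam.pr (0 : Fin 1)) (fun _ => t) c b
  rw [Lam.pr_comp] at e
  rw [e, evalAt]
  congr 2
  funext i
  fin_cases i
  rfl

theorem evalAt_act_lamIter {n m : ℕ} (b : Fin n → A) (u : Lam.Op (m + n)) (c : Fin m → A) :
    S.evalAt b (S.act (Lam.lamIter n u) c) = S.act u (Fin.append c b) := by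
  rw [evalAt_act, Lam.rhoIter_lamIter]

/-! ### The algebra A(n), the map ι and the indeterminates -/

/-- The `Λ`-algebra structure of the retract `A(n)`. -/
noncomputable def retractAlg (n : ℕ) : Alg Lam (S.retract n) where
  act t a := ⟨S.act (Lam.lamIter n (Lam.comp t fun i => Lam.rhoIter n (Lam.pr i)))
    (fun i => (a i : A)), S.act_lamIter_mem_retract _ _⟩
  act_pr i a := Subtype.ext <| by
    simp only [Lam.pr_comp]
    exact S.act_lamIter_rhoIter_pr i _ (a i).2
  act_comp t s a := Subtype.ext <| by
    simp only [S.act_lamIter_act, Lam.comp_assoc, Lam.comp_rhoIter_pr, Lam.rhoIter_lamIter]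

theorem coe_retractAlg_act {n m : ℕ} (t : Lam.Op m) (a : Fin m → S.retract n) :
    ((S.retractAlg n).act t a : A) =
      S.act (Lam.lamIter n (Lam.comp t fun i => Lam.rhoIter n (Lam.pr i)))
        (fun i => (a i : A)) := rfl

theorem act_lamIter_pr_act {n m : ℕ} (t : Lam.Op m) (a : Fin m → A) :
    S.act (Lam.lamIter n (Lam.pr (Fin.castAdd n (0 : Fin 1)))) ![S.act t a]
      = S.act (Lam.lamIter n (Lam.comp t fun i => Lam.pr (Fin.castAdd n i))) a := by
  have e := S.act_lamIter_act (n := n) (Lam.pr (Fin.castAdd n (0 : Fin 1))) (fun _ => t) a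
  rw [Lam.pr_comp, Lam.liftIter_castAdd] at e
  rw [← e]
  congr 1
  funext i
  fin_cases i
  rfl

/-- The homomorphism `a ↦ λ z₁ ⋯ zₙ. a` from `A` to `A(n)`. -/
noncomputable def retractConst (n : ℕ) : Hom S (S.retractAlg n) where
  toFun a := ⟨S.act (Lam.lamIter n (Lam.pr (Fin.castAdd n (0 : Fin 1)))) ![a],
    S.act_lamIter_mem_retract _ _⟩
  map_act t a := Subtype.ext <| by
    -- Expresses every ι(aᵢ) over the common tuple `a`, as `act_lamIter_act` requires.
    have e (i) : S.act (Lam.lamIter n (Lam.pr (Fin.castAdd n (0 : Fin 1)))) ![a i]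
        = S.act (Lam.lamIter n (Lam.pr (Fin.castAdd n i))) a := by
      have := S.act_lamIter_pr_act (n := n) (Lam.pr i) a
      rwa [S.act_pr, Lam.pr_comp] at this
    simp only [coe_retractAlg_act, act_lamIter_pr_act, e, S.act_lamIter_act, Lam.comp_assoc,
      Lam.comp_rhoIter_pr, Lam.rhoIter_lamIter]

/-- The element `λ z₁ ⋯ zₙ. zᵢ` of `A(n)`. -/
noncomputable def retractVar (n : ℕ) (i : Fin n) : S.retract n :=
  ⟨S.const (Lam.lamIter n (Lam.pr (Fin.natAdd 0 i))), S.act_lamIter_mem_retract _ _⟩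

/-- The dummy parameter `a` puts ξᵢ over the same one-element tuple as ι(a). -/
theorem coe_retractVar {n : ℕ} (i : Fin n) (a : A) :
    (S.retractVar n i : A) = S.act (Lam.lamIter n (Lam.pr (Fin.natAdd 1 i))) ![a] := by
  have e : Lam.comp (Lam.lamIter n (Lam.pr (Fin.natAdd 0 i))) Fin.elim0
      = Lam.lamIter n (Lam.pr (Fin.natAdd 1 i)) := by
    rw [Lam.comp_lamIter, Lam.pr_comp, Lam.liftIter_natAdd]
  rw [← e, S.act_comp]
  change S.act _ _ = _
  congr 1
  funext i
  exact i.elim0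

/-- Every element `a` of `A(n)` is `ι a` applied to the indeterminates. -/
theorem evalAt_retractVar {n : ℕ} (a : S.retract n) :
    (S.retractAlg n).evalAt (S.retractVar n) ((S.retractConst n).toFun a) = a := by
  -- In Λ(1+n), variable 0 stands for a and the others for z₁, …, zₙ. So ι(a), ξ₁, …, ξₙ are
  -- uniformly the abstractions of projections; cancelling ρⁿλⁿ leaves λz₁⋯zₙ. a z₁⋯zₙ.
  have e : (fun i => ((Fin.append ![(S.retractConst n).toFun a] (S.retractVar n) i :
      S.retract n) : A)) = fun i => S.act (Lam.lamIter n (Lam.pr i)) ![(a : A)] := by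
    funext i
    refine Fin.addCases (fun i => ?_) (fun i => ?_) i
    · rw [Fin.append_left]
      fin_cases i
      rfl
    · rw [Fin.append_right]
      exact S.coe_retractVar i a
  refine Subtype.ext ?_
  rw [evalAt, coe_retractAlg_act, e]
  simp only [S.act_lamIter_act, Lam.comp_assoc, Lam.comp_rhoIter_pr, Lam.rhoIter_lamIter,
    Lam.comp_pr]
  exact S.mem_retract.1 a.2

/-! ### The universal property -/

/-- The extension of a homomorphism `f : A → B` to `A(n)`, with values `b` at the
indeterminates. -/
noncomputable def retractLift {B : Type w} {SB : Alg Lam B} {n : ℕ} (f : Hom S SB)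
    (b : Fin n → B) : Hom (S.retractAlg n) SB where
  toFun a := SB.evalAt b (f.toFun a)
  map_act t a := by
    -- Expresses each f(aᵢ) b₁⋯bₙ over the joint tuple of all f(aⱼ) and `b`, to match the result of
    -- β on the other side.
    have e (i) : SB.evalAt b (f.toFun (a i))
        = SB.act (Lam.rhoIter n (Lam.pr i)) (Fin.append (fun i => f.toFun (a i)) b) := by
      rw [← SB.evalAt_act, SB.act_pr]
    simp only [coe_retractAlg_act, f.map_act, evalAt_act_lamIter, SB.act_comp, e]

theorem map_evalAt {B : Type w} {SB : Alg Lam B} (g : Hom S SB) {n : ℕ} (b : Fin n → A) (c : A) :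
    g.toFun (S.evalAt b c) = SB.evalAt (fun i => g.toFun (b i)) (g.toFun c) := by
  rw [evalAt, g.map_act, evalAt]
  congr 1
  funext i
  refine Fin.addCases (fun i => ?_) (fun i => ?_) i
  · fin_cases i
    simp only [Fin.append_left]
    rfl
  · simp only [Fin.append_right]

theorem isFreeExtension_retract (n : ℕ) :
    IsFreeExtension.{0, v, w} (S.retractConst n) (S.retractVar n) := by
  intro B SB f b
  refine ⟨S.retractLift f b, ⟨fun a => ?_, fun i => ?_⟩, ?_⟩
  · change SB.evalAt b (f.toFun (S.act _ _)) = _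
    rw [f.map_act, evalAt_act_lamIter, SB.act_pr, Fin.append_left]
    rfl
  · change SB.evalAt b (f.toFun (S.act _ _)) = _
    rw [f.map_act, evalAt_act_lamIter, SB.act_pr, Fin.append_right]
  · rintro g ⟨hι, hx⟩
    refine Hom.ext (funext fun a => ?_)
    change g.toFun a = SB.evalAt b (f.toFun a)
    -- f(a) b₁⋯bₙ = g(ι a) g(ξ₁)⋯g(ξₙ) = g(ι(a) ξ₁⋯ξₙ) = g(a).
    rw [← hι, ← funext hx, ← map_evalAt, evalAt_retractVar]

end AlgTheory.Alg

/-- For every `Λ`-algebra `A`, the retract `A(n)` carries the `Λ`-algebra structure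
`t(a₁, …, aₘ) = λ z₁ ⋯ zₙ. t(a₁ z₁ ⋯ zₙ, …, aₘ z₁ ⋯ zₙ)`, and with the map
`a ↦ λ z₁ ⋯ zₙ. a` and the elements `λ z₁ ⋯ zₙ. zᵢ` it is the free extension of `A` by `n`
indeterminates. -/
theorem mainTheorem9 {A : Type v} (S : AlgTheory.Alg Lam A) (n : ℕ) :
    ∃ Sn : AlgTheory.Alg Lam (S.retract n),
      (∀ {m : ℕ} (t : Lam.Op m) (a : Fin m → S.retract n),
        (Sn.act t a : A) =
          S.act (Lam.lamIter n (Lam.comp t fun i => Lam.rhoIter n (Lam.pr i)))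
            (fun i => (a i : A))) ∧
      ∃ (ι : AlgTheory.Hom S Sn) (x : Fin n → S.retract n),
        (∀ a : A, (ι.toFun a : A) =
          S.act (Lam.lamIter n (Lam.pr (Fin.castAdd n (0 : Fin 1)))) ![a]) ∧
        (∀ i : Fin n, (x i : A) = S.const (Lam.lamIter n (Lam.pr (Fin.natAdd 0 i)))) ∧
        AlgTheory.IsFreeExtension.{0, v, w} ι x := by
  exact ⟨S.retractAlg n, fun _ _ => rfl, S.retractConst n, S.retractVar n, fun _ => rfl,
    fun _ => rfl, S.isFreeExtension_retract n⟩
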